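/- **Theorem 2.2.** Let $\mathbb D$ be the open unit disc and let $A(\mathbb D)$ be the disc algebra, that is, the algebra of continuous functions on $\overline{\mathbb D}$ which are holomorphic on $\mathbb D$, with the supremum norm. A Hilbert module over $A(\mathbb D)$ is a complex Hilbert space $\mathcal R$ with a unital, $\mathbb C$-bilinear, continuous module action $A(\mathbb D)\times\mathcal R\to\mathcal R$. For $\omega\in\mathbb D$ let $I_\omega\subset\mathbb C[z]$ be the ideal of polynomials vanishing at $\omega$, let $\mathcal R_\omega=\mathcal R/(I_\omega\cdot\mathcal R)$ with its quotient norm, and for $f\in\mathcal R$ let $\hat f(\omega)$ be the image of $f$ in $\mathcal R_\omega$. The module $\mathcal R$ is quasi-free of finite multiplicity $m$ if $\dim_{\mathbb C}\mathcal R_\omega=m<\infty$ for all $\omega\in\mathbb D$ and $E_{\mathcal R}=\bigcup_{\omega\in\mathbb D}\mathcal R_\omega$ can be given the structure of a Hermitian holomorphic vector bundle over $\mathbb D$, with the quotient metric on the fibres, so that every section $\hat f$, $f\in\mathcal R$, is holomorphic and the map $f\mapsto\hat f$ is one-to-one. The curvature of (the Chern connection of) $E_{\mathcal R}$ is the endomorphism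 $\mathcal K_{\mathcal R}(\omega)$ of $\mathcal R_\omega$ which, in a local holomorphic frame $s_1,\dots,s_m$ with Gram matrix $H=(\langle s_j,s_i\rangle)_{i,j}$, has the matrix $\bar\partial\,(H^{-1}\partial H)$, where $\partial=\partial/\partial\omega$ and $\bar\partial=\partial/\partial\bar\omega$. A reducing submodule of $\mathcal R$ is a closed submodule $\mathcal L$ such that $\mathcal R=\mathcal L\oplus\mathcal L'$ (orthogonal direct sum) for some closed submodule $\mathcal L'$; the reducing submodules form a lattice under intersection and closed sum. Let $\mathcal R$ be a quasi-free Hilbert module over $A(\mathbb D)$ of finite multiplicity $m$, and suppose that there is a point $\omega_0\in\mathbb D$ at which the curvature $\mathcal K_{\mathcal R}(\omega_0)$ has $m$ distinct eigenvalues. Then the lattice of reducing submodules of $\mathcal R$ is finite, and it is discrete in the topology given by the operator norm distance $\|P_{\mathcal L_1}-P_{\mathcal L_2}\|$ of the orthogonal projections onto the submodules. -/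

import Mathlib

open Bundle Manifold
open scoped ContDiff InnerProductSpace

noncomputable section

/-! ### The disc algebra and Hilbert modules over it -/

/-- The open unit disc `𝔻`, as an open subset (hence a complex submanifold) of `ℂ`. -/
abbrev OpenDisc : TopologicalSpace.Opens ℂ := ⟨Metric.ball 0 1, Metric.isOpen_ball⟩

/-- The disc algebra `A(𝔻)`: the continuous functions on the closed unit disc which are holomorphic
on the open unit disc, with the supremum norm inherited from `C(closedBall 0 1, ℂ)`. -/
def DiscAlgebra : Subalgebra ℂ C(Metric.closedBall (0 : ℂ) 1, ℂ) where
  carrier := {f | ∃ g : ℂ → ℂ, DifferentiableOn ℂ g (Metric.ball 0 1) ∧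
    ∀ z : Metric.closedBall (0 : ℂ) 1, (z : ℂ) ∈ Metric.ball (0 : ℂ) 1 → f z = g z}
  mul_mem' := by
    rintro a b ⟨g, hg, ha⟩ ⟨h, hh, hb⟩
    exact ⟨g * h, hg.mul hh, fun z hz => by simp [ha z hz, hb z hz]⟩
  add_mem' := by
    rintro a b ⟨g, hg, ha⟩ ⟨h, hh, hb⟩
    exact ⟨g + h, hg.add hh, fun z hz => by simp [ha z hz, hb z hz]⟩
  algebraMap_mem' := fun c =>
    ⟨fun _ => c, differentiableOn_const c, fun z _ => rfl⟩

/-- The coordinate function `z` in `A(𝔻)`. -/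
def DiscAlgebra.coord : DiscAlgebra :=
  ⟨⟨fun z => (z : ℂ), continuous_subtype_val⟩, fun z => z, differentiableOn_id, fun _ _ => rfl⟩

/-- A Hilbert module over `A(𝔻)`: a complex Hilbert space which is a unital module over `A(𝔻)`,
with `ℂ`-bilinear and (jointly) continuous module multiplication `A(𝔻) × R → R`. -/
class DiscHilbertModule (R : Type*) [NormedAddCommGroup R] [InnerProductSpace ℂ R] extends
    CompleteSpace R, Module DiscAlgebra R, IsScalarTower ℂ DiscAlgebra R,
    ContinuousSMul DiscAlgebra R

namespace DiscHilbertModule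

variable (R : Type*) [NormedAddCommGroup R] [InnerProductSpace ℂ R] [DiscHilbertModule R]

/-! ### Localization: the fibres `R_w = R / I_w R` -/

/-- `I_w · R`, where `I_w` is the maximal ideal of polynomials vanishing at `w`. -/
def maxIdealMul (w : ℂ) : Submodule ℂ R :=
  Submodule.span ℂ
    {x | ∃ (p : Polynomial ℂ) (f : R), p.eval w = 0 ∧ x = Polynomial.aeval DiscAlgebra.coord p • f}

/-- The localization `R_w = R / I_w R` of `R` at a point `w` of the disc. -/
abbrev Fiber (w : OpenDisc) : Type _ := R ⧸ maxIdealMul R (w : ℂ)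

variable {R}

/-- The section `f̂` determined by a vector `f` of `R`: `f̂ w` is the class of `f` in `R_w`. -/
def hat (f : R) (w : OpenDisc) : Fiber R w := (maxIdealMul R (w : ℂ)).mkQ f

/-- The representative of least norm of a class in `R_w = R / I_w R`, that is, its
representative in the orthogonal complement of `I_w R`
(for closed `I_w R`; in general, of the image of the class in `R / [I_w R]`). -/
def fiberLift (w : OpenDisc) : Fiber R w →ₗ[ℂ] R :=
  (maxIdealMul R (w : ℂ)).liftQ
    ((maxIdealMul R (w : ℂ))ᗮ.starProjection : R →L[ℂ] R).toLinearMap (by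
      intro x hx
      rw [LinearMap.mem_ker]
      exact (Submodule.starProjection_apply_eq_zero_iff _).2
        (Submodule.le_orthogonal_orthogonal _ hx))

/-- The quotient Hilbert space inner product on the fibre `R_w = R / I_w R`
(conjugate linear in the first variable). -/
def fiberInner (w : OpenDisc) (u v : Fiber R w) : ℂ := ⟪fiberLift w u, fiberLift w v⟫_ℂ

variable (R)

/-! ### Quasi-free modules -/

/-- The model fibre `ℂᵐ`. -/
abbrev ModelFiber (m : ℕ) : Type := EuclideanSpace ℂ (Fin m)

/-- `R` is quasi-free of multiplicity `m`: every fibre `R_w` has dimension `m`, and the disjoint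
union of the fibres `R_w` carries the structure of a Hermitian holomorphic vector bundle `E_R` over
the disc, the metric being the quotient metric of the fibres, such that every section `f̂` is
holomorphic and `f ↦ f̂` is one-to-one. An element of this structure is such a bundle `E_R`.
(Smoothness `ω` over `ℂ` means holomorphic; smoothness `∞` over `ℝ` means infinitely
differentiable.) -/
structure QuasiFree (m : ℕ) where
  rank_fiber : ∀ w : OpenDisc, Module.rank ℂ (Fiber R w) = m
  [topology : TopologicalSpace (TotalSpace (ModelFiber m) (Fiber R))]
  [fiberBundle : FiberBundle (ModelFiber m) (Fiber R)]
  [vectorBundle : VectorBundle ℂ (ModelFiber m) (Fiber R)]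
  [holomorphicBundle : ContMDiffVectorBundle ω (ModelFiber m) (Fiber R) 𝓘(ℂ, ℂ)]
  /-- The metric is smooth: the inner product of two local holomorphic sections is smooth. -/
  smooth_metric : ∀ (U : Set OpenDisc), IsOpen U → ∀ s t : (w : OpenDisc) → Fiber R w,
    ContMDiffOn 𝓘(ℂ, ℂ) (𝓘(ℂ, ℂ).prod 𝓘(ℂ, ModelFiber m)) ω
      (fun w => TotalSpace.mk' (ModelFiber m) w (s w)) U →
    ContMDiffOn 𝓘(ℂ, ℂ) (𝓘(ℂ, ℂ).prod 𝓘(ℂ, ModelFiber m)) ω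
      (fun w => TotalSpace.mk' (ModelFiber m) w (t w)) U →
    ContMDiffOn 𝓘(ℝ, ℂ) 𝓘(ℝ, ℂ) ∞ (fun w => fiberInner w (s w) (t w)) U
  holomorphic_hat : ∀ f : R,
    ContMDiff 𝓘(ℂ, ℂ) (𝓘(ℂ, ℂ).prod 𝓘(ℂ, ModelFiber m)) ω
      (fun w => TotalSpace.mk' (ModelFiber m) w (hat f w))
  injective_hat : Function.Injective (hat : R → (w : OpenDisc) → Fiber R w)

/-! ### Curvature -/

/-- The Wirtinger derivative `∂f/∂z`. -/
def wirtinger (f : ℂ → ℂ) (z : ℂ) : ℂ :=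
  (fderiv ℝ f z 1 - Complex.I * fderiv ℝ f z Complex.I) / 2

/-- The Wirtinger derivative `∂f/∂z̄`. -/
def wirtingerBar (f : ℂ → ℂ) (z : ℂ) : ℂ :=
  (fderiv ℝ f z 1 + Complex.I * fderiv ℝ f z Complex.I) / 2

namespace QuasiFree

variable {R} {m : ℕ} (E : QuasiFree R m)

/-- The holomorphic frame `s₁, …, s_m` of `E_R` near `w₀` given by the preferred local
trivialization at `w₀`. -/
def frame (w₀ : OpenDisc) (i : Fin m) (w : OpenDisc) : Fiber R w :=
  letI := E.topology
  letI := E.fiberBundle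
  (trivializationAt (ModelFiber m) (Fiber R) w₀).symm w (EuclideanSpace.single i 1)

/-- The Gram matrix `H = (⟨s_j, s_i⟩)_{ij}` (inner product linear in `s_j`) of the holomorphic frame
near `w₀`, as a function of a complex variable (extended by `0` outside of the disc). -/
def gram (w₀ : OpenDisc) : ℂ → Matrix (Fin m) (Fin m) ℂ :=
  Function.extend (fun w : OpenDisc => (w : ℂ))
    (fun w => Matrix.of fun i j => fiberInner w (E.frame w₀ i w) (E.frame w₀ j w)) 0

/-- The matrix `H⁻¹ ∂H` of the Chern connection (the canonical connection) of `E_R` in the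
holomorphic frame near `w₀`. -/
def connectionMatrix (w₀ : OpenDisc) (z : ℂ) : Matrix (Fin m) (Fin m) ℂ :=
  (E.gram w₀ z)⁻¹ * Matrix.of fun i j => wirtinger (fun ζ => E.gram w₀ ζ i j) z

/-- The matrix `∂̄(H⁻¹ ∂H)` of the curvature of `E_R` in the holomorphic frame near `w₀`. -/
def curvatureMatrix (w₀ : OpenDisc) (z : ℂ) : Matrix (Fin m) (Fin m) ℂ :=
  Matrix.of fun i j => wirtingerBar (fun ζ => E.connectionMatrix w₀ ζ i j) z

/-- The curvature `K(w₀)` of `E_R` at `w₀`, the coefficient of the `(1,1)`-form with values in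
the endomorphisms of the bundle, as an endomorphism of the fibre `R_{w₀}`. A change of the
holomorphic frame by `g` replaces the matrix `∂̄(H⁻¹ ∂H)` by its conjugate by `g`, so that the
endomorphism does not depend on the choice of the frame. -/
def curvature (w₀ : OpenDisc) : Module.End ℂ (Fiber R w₀) :=
  letI := E.topology
  letI := E.fiberBundle
  letI := E.vectorBundle
  ((trivializationAt (ModelFiber m) (Fiber R) w₀).linearEquivAt ℂ w₀
    (mem_baseSet_trivializationAt (ModelFiber m) (Fiber R) w₀)).symm.conj
    (Matrix.toLpLin 2 2 (E.curvatureMatrix w₀ (w₀ : ℂ)))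

end QuasiFree

/-! ### The lattice of reducing submodules -/

variable {R}

/-- `R = L ⊕ L'`, an orthogonal direct sum of (closed) submodules. -/
def IsOrthogonalSum (L L' : ClosedSubmodule DiscAlgebra R) : Prop :=
  (∀ x ∈ L, ∀ y ∈ L', ⟪x, y⟫_ℂ = 0) ∧ L.toSubmodule ⊔ L'.toSubmodule = ⊤

/-- A (closed) submodule `L` of `R` is reducing if `R = L ⊕ L'`, an orthogonal direct sum, for some
(closed) submodule `L'`. -/
def IsReducing (L : ClosedSubmodule DiscAlgebra R) : Prop :=
  ∃ L' : ClosedSubmodule DiscAlgebra R, IsOrthogonalSum L L'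

/-- A closed submodule, seen as a closed linear subspace. -/
def subspace (L : ClosedSubmodule DiscAlgebra R) : Submodule ℂ R :=
  L.toSubmodule.restrictScalars ℂ

instance (L : ClosedSubmodule DiscAlgebra R) : CompleteSpace (subspace L) :=
  L.isClosed.completeSpace_coe

theorem mem_subspace {L : ClosedSubmodule DiscAlgebra R} {x : R} : x ∈ subspace L ↔ x ∈ L :=
  Iff.rfl

theorem IsOrthogonalSum.symm {L L' : ClosedSubmodule DiscAlgebra R} (h : IsOrthogonalSum L L') :
    IsOrthogonalSum L' L :=
  ⟨fun x hx y hy => inner_eq_zero_symm.1 (h.1 y hy x hx), by rw [sup_comm]; exact h.2⟩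

theorem IsOrthogonalSum.orthogonal_le {L L' : ClosedSubmodule DiscAlgebra R}
    (h : IsOrthogonalSum L L') : (subspace L)ᗮ ≤ subspace L' := by
  intro x hx
  obtain ⟨y, hy, z, hz, rfl⟩ := Submodule.mem_sup.1 (h.2 ▸ Submodule.mem_top : x ∈ _)
  have h1 := hx y hy
  rw [inner_add_right, h.1 y hy z hz, add_zero, inner_self_eq_zero] at h1
  rw [h1, zero_add]
  exact hz

theorem IsOrthogonalSum.inf_sup {L L' M M' : ClosedSubmodule DiscAlgebra R}
    (hL : IsOrthogonalSum L L') (hM : IsOrthogonalSum M M') :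
    IsOrthogonalSum (L ⊓ M) (L' ⊔ M') := by
  have h1 : subspace (L' ⊔ M') ≤ (subspace (L ⊓ M))ᗮ := by
    intro y hy
    have hy' : y ∈ closure ((L'.toSubmodule ⊔ M'.toSubmodule : Submodule DiscAlgebra R) : Set R) :=
      hy
    refine closure_minimal ?_ (Submodule.isClosed_orthogonal _) hy'
    intro z hz
    obtain ⟨a, ha, b, hb, rfl⟩ := Submodule.mem_sup.1 hz
    intro x hx
    rw [inner_add_right, hL.1 x hx.1 a ha, hM.1 x hx.2 b hb, add_zero]
  have h2 : (subspace (L' ⊔ M'))ᗮ ≤ subspace (L ⊓ M) := fun x hx =>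
    ⟨hL.symm.orthogonal_le fun y hy => hx y ((le_sup_left : L' ≤ L' ⊔ M') hy),
      hM.symm.orthogonal_le fun y hy => hx y ((le_sup_right : M' ≤ L' ⊔ M') hy)⟩
  have h3 : (subspace (L ⊓ M))ᗮ ≤ subspace (L' ⊔ M') := by
    have := Submodule.orthogonal_le h2
    rwa [Submodule.orthogonal_orthogonal] at this
  refine ⟨fun x hx y hy => h1 hy x hx, eq_top_iff.2 fun x _ => ?_⟩
  have hx : x ∈ subspace (L ⊓ M) ⊔ (subspace (L ⊓ M))ᗮ := by
    rw [Submodule.sup_orthogonal_of_hasOrthogonalProjection]; exact Submodule.mem_top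
  obtain ⟨a, ha, b, hb, rfl⟩ := Submodule.mem_sup.1 hx
  exact Submodule.add_mem_sup ha (h3 hb)

variable (R)

/-- The lattice of reducing submodules of `R`, as a sublattice of the lattice of closed submodules
(`⊓` is the intersection and `⊔` the closure of the sum). -/
def reducingSubmodules : Sublattice (ClosedSubmodule DiscAlgebra R) where
  carrier := {L | IsReducing L}
  supClosed' := by
    rintro L ⟨L', hL⟩ M ⟨M', hM⟩
    exact ⟨L' ⊓ M', (hL.symm.inf_sup hM.symm).symm⟩
  infClosed' := by
    rintro L ⟨L', hL⟩ M ⟨M', hM⟩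
    exact ⟨L' ⊔ M', hL.inf_sup hM⟩

/-- The topology on the lattice of reducing submodules: submodules are close if the orthogonal
projections onto them are close in operator norm. -/
instance : TopologicalSpace (reducingSubmodules R) :=
  TopologicalSpace.induced
    (fun L => ((subspace (L : ClosedSubmodule DiscAlgebra R)).starProjection : R →L[ℂ] R))
    inferInstance

end DiscHilbertModule

end

noncomputable section

/-! The projection onto a reducing submodule is a self-adjoint idempotent module map, so it
preserves every `I_w R` and induces an idempotent on each fibre, self-adjoint for the quotient
metric. These fibre maps form a holomorphic bundle endomorphism, and two facts about self-adjoint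
ones carry the proof.

Locality (`eq_zero_of_fiberMap_eq_zero`): for a self-adjoint module map `T`, the trace of `T_w²` is
holomorphic in `w` and real, being a squared Hilbert–Schmidt norm, hence constant. If `T` vanishes
on one fibre it vanishes on all, and then `T = 0` because `f ↦ f̂` is one-to-one. So a projection is
determined by its value on the fibre at `w₀`.

Parallelism (`commute_curvature_of_selfAdjoint`): a holomorphic self-adjoint endomorphism is
parallel for the Chern connection, hence commutes with the curvature.

The lattice therefore embeds in the set of idempotents commuting with the curvature at `w₀`. With
`m` distinct eigenvalues these are diagonal in an eigenbasis with entries 0 or 1, so they are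
finitely many. Discreteness follows, since a finite T1 space is discrete. -/

/-- A bounded operator on a Hilbert space whose range has finite codimension has closed range. -/
theorem ContinuousLinearMap.isClosed_range_of_finiteDimensional_quotient {H : Type*}
    [NormedAddCommGroup H] [InnerProductSpace ℂ H] [CompleteSpace H] (T : H →L[ℂ] H)
    [FiniteDimensional ℂ (H ⧸ T.range)] : IsClosed (T.range : Set H) := by
  obtain ⟨G, hG⟩ := Submodule.exists_isCompl T.range
  have hGfin : FiniteDimensional ℂ G :=
    (Submodule.quotientEquivOfIsCompl _ _ hG).finiteDimensional
  have hker : IsClosed (T.ker : Set H) := T.isClosed_ker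
  have : CompleteSpace T.ker := hker.completeSpace_coe
  -- Restricting to the complement of the kernel gives an injective operator with the same range; an
  -- injective operator whose range has a closed complement has closed range.
  let S : (T.kerᗮ : Submodule ℂ H) →L[ℂ] H := T ∘L T.kerᗮ.subtypeL
  have hS : S.range = T.range := by
    apply le_antisymm
    · rintro _ ⟨x, rfl⟩
      exact ⟨x, rfl⟩
    · rintro _ ⟨x, rfl⟩
      refine ⟨⟨x - T.ker.starProjection x, T.ker.sub_starProjection_mem_orthogonal x⟩, ?_⟩
      have : T (T.ker.starProjection x) = 0 := T.ker.starProjection_apply_mem x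
      simp [S, this]
  have hSker : S.ker = ⊥ := by
    rw [LinearMap.ker_eq_bot']
    intro x hx
    have h1 : (x : H) ∈ T.ker := hx
    have := x.2 x h1
    exact Subtype.ext (inner_self_eq_zero.1 this)
  have := S.closed_complemented_range_of_isCompl_of_ker_eq_bot G (hS ▸ hG)
    G.closed_of_finiteDimensional hSker
  rwa [hS] at this

namespace DiscHilbertModule

variable {R : Type*} [NormedAddCommGroup R] [InnerProductSpace ℂ R] [DiscHilbertModule R]

/-! ### Fibres and module maps -/

/-- The action of an element of the disc algebra as a bounded operator. -/
def smulCLM (a : DiscAlgebra) : R →L[ℂ] R where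
  toFun x := a • x
  map_add' := smul_add a
  map_smul' c x := by
    rw [RingHom.id_apply, ← algebraMap_smul DiscAlgebra c x, ← algebraMap_smul DiscAlgebra c (a • x),
      smul_smul, smul_smul, mul_comm]
  cont := continuous_const_smul a

/-- A polynomial vanishing at `w` is divisible by `X - w`, so `I_w R` is the range of a single
bounded operator and the closed range criterion applies. -/
theorem maxIdealMul_eq_range (w : ℂ) :
    maxIdealMul R w =
      (smulCLM (R := R) (Polynomial.aeval DiscAlgebra.coord
        (Polynomial.X - Polynomial.C w))).range := by
  apply le_antisymm
  · refine Submodule.span_le.2 ?_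
    rintro _ ⟨p, f, hp, rfl⟩
    obtain ⟨q, rfl⟩ := Polynomial.dvd_iff_isRoot.2 hp
    refine ⟨Polynomial.aeval DiscAlgebra.coord q • f, ?_⟩
    rw [map_mul, mul_smul]
    rfl
  · rintro _ ⟨f, rfl⟩
    exact Submodule.subset_span ⟨_, f, by simp, rfl⟩

theorem isClosed_maxIdealMul (w : OpenDisc) [FiniteDimensional ℂ (Fiber R w)] :
    IsClosed (maxIdealMul R (w : ℂ) : Set R) := by
  rename_i h
  unfold Fiber at h
  rw [maxIdealMul_eq_range] at h ⊢
  exact ContinuousLinearMap.isClosed_range_of_finiteDimensional_quotient _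

theorem maxIdealMul_le_comap (T : R →ₗ[DiscAlgebra] R) (w : ℂ) :
    maxIdealMul R w ≤ (maxIdealMul R w).comap (T.restrictScalars ℂ) := by
  refine Submodule.span_le.2 ?_
  rintro _ ⟨p, f, hp, rfl⟩
  exact Submodule.subset_span ⟨p, T f, hp, by simp⟩

/-- The endomorphism of the fibre `R_w` induced by a module map. -/
def fiberMap (T : R →ₗ[DiscAlgebra] R) (w : OpenDisc) : Module.End ℂ (Fiber R w) :=
  (maxIdealMul R (w : ℂ)).mapQ _ (T.restrictScalars ℂ) (maxIdealMul_le_comap T w)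

@[simp]
theorem fiberMap_hat (T : R →ₗ[DiscAlgebra] R) (w : OpenDisc) (f : R) :
    fiberMap T w (hat f w) = hat (T f) w := rfl

theorem hat_surjective (w : OpenDisc) (u : Fiber R w) : ∃ f : R, hat f w = u :=
  (maxIdealMul R (w : ℂ)).mkQ_surjective u

theorem fiberMap_sub (S T : R →ₗ[DiscAlgebra] R) (w : OpenDisc) :
    fiberMap (S - T) w = fiberMap S w - fiberMap T w := by
  refine LinearMap.ext fun u => ?_
  obtain ⟨f, rfl⟩ := hat_surjective w u
  rfl

theorem fiberLift_hat (w : OpenDisc) (f : R) :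
    fiberLift w (hat f w) = (maxIdealMul R (w : ℂ))ᗮ.starProjection f := rfl

section FiniteDimensional

variable (w : OpenDisc) [FiniteDimensional ℂ (Fiber R w)]

/-- Closedness of `I_w R` makes it equal to its double orthogonal complement; the quotient form is
then definite. -/
theorem fiberLift_injective : Function.Injective (fiberLift (R := R) w) := by
  have : CompleteSpace (maxIdealMul R (w : ℂ)) := (isClosed_maxIdealMul w).completeSpace_coe
  refine (injective_iff_map_eq_zero _).2 fun u hu => ?_
  obtain ⟨f, rfl⟩ := hat_surjective w u
  rw [fiberLift_hat, Submodule.starProjection_apply_eq_zero_iff,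
    Submodule.orthogonal_orthogonal] at hu
  exact (Submodule.Quotient.mk_eq_zero _).2 hu

/-- A self-adjoint map preserving `I_w R` also preserves its orthogonal complement, hence commutes
with the projection onto that complement. -/
theorem fiberLift_fiberMap {T : R →ₗ[DiscAlgebra] R} (hT : ∀ x y, ⟪T x, y⟫_ℂ = ⟪x, T y⟫_ℂ)
    (u : Fiber R w) : fiberLift w (fiberMap T w u) = T (fiberLift w u) := by
  have : CompleteSpace (maxIdealMul R (w : ℂ)) := (isClosed_maxIdealMul w).completeSpace_coe
  obtain ⟨f, rfl⟩ := hat_surjective w u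
  rw [fiberMap_hat, fiberLift_hat, fiberLift_hat]
  refine Submodule.eq_starProjection_of_mem_orthogonal (fun x hx => ?_) ?_
  · rw [← hT]
    exact Submodule.starProjection_apply_mem (maxIdealMul R (w : ℂ))ᗮ f _
      (maxIdealMul_le_comap T w hx)
  · rw [Submodule.orthogonal_orthogonal, ← map_sub]
    refine maxIdealMul_le_comap T w ?_
    have := Submodule.sub_starProjection_mem_orthogonal (K := (maxIdealMul R (w : ℂ))ᗮ) f
    rwa [Submodule.orthogonal_orthogonal] at this

theorem fiberInner_fiberMap {T : R →ₗ[DiscAlgebra] R} (hT : ∀ x y, ⟪T x, y⟫_ℂ = ⟪x, T y⟫_ℂ)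
    (u v : Fiber R w) : fiberInner w (fiberMap T w u) v = fiberInner w u (fiberMap T w v) := by
  rw [fiberInner, fiberInner, fiberLift_fiberMap w hT, fiberLift_fiberMap w hT, hT]

/-- The squared Hilbert–Schmidt norm of the map induced on a fibre by a self-adjoint module map. -/
theorem trace_fiberMap_sq {T : R →ₗ[DiscAlgebra] R} (hT : ∀ x y, ⟪T x, y⟫_ℂ = ⟪x, T y⟫_ℂ) :
    ∃ r : ℝ, LinearMap.trace ℂ (Fiber R w) (fiberMap T w * fiberMap T w) = r ∧
      (r = 0 → fiberMap T w = 0) := by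
  -- The fibre is moved to a subspace of `R`, where the quotient inner product is the ambient one
  -- and the induced map is the restriction of `T`.
  let e := LinearEquiv.ofInjective (fiberLift (R := R) w) (fiberLift_injective w)
  have : FiniteDimensional ℂ (fiberLift (R := R) w).range := e.finiteDimensional
  let b := stdOrthonormalBasis ℂ (fiberLift (R := R) w).range
  let S : Module.End ℂ (fiberLift (R := R) w).range := e.conj (fiberMap T w)
  have he : ∀ u, (S (e u) : R) = T (e u) := fun u => by
    simp only [S, LinearEquiv.conj_apply_apply, LinearEquiv.symm_apply_apply]
    exact fiberLift_fiberMap w hT u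
  have hS : ∀ x, (S x : R) = T x := fun x => by
    simpa using he (e.symm x)
  refine ⟨∑ i, ‖S (b i)‖ ^ 2, ?_, fun h => ?_⟩
  · rw [← LinearMap.trace_conj' _ e, LinearMap.trace_eq_sum_inner _ b]
    push_cast
    refine Finset.sum_congr rfl fun i _ => ?_
    have : e.conj (fiberMap T w * fiberMap T w) (b i) = S (S (b i)) := by
      simp [S, LinearEquiv.conj_apply_apply]
    rw [this, ← Complex.coe_algebraMap, ← inner_self_eq_norm_sq_to_K (𝕜 := ℂ), Submodule.coe_inner,
      Submodule.coe_inner, hS (S (b i)), ← hT, ← hS]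
  · have h0 : S = 0 := b.toBasis.ext fun i => by
      have := (Finset.sum_eq_zero_iff_of_nonneg fun i _ => by positivity).1 h i (Finset.mem_univ i)
      simpa using this
    exact e.conj.injective (by rw [map_zero]; exact h0)

end FiniteDimensional

/-! ### Projections onto reducing submodules -/

theorem IsOrthogonalSum.starProjection_eq {L L' : ClosedSubmodule DiscAlgebra R}
    (h : IsOrthogonalSum L L') {y z : R} (hy : y ∈ L) (hz : z ∈ L') :
    (subspace L).starProjection (y + z) = y :=
  (Submodule.eq_starProjection_of_mem_orthogonal' (K := subspace L) hy
    (fun x hx => h.1 x hx z hz) rfl)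

theorem IsReducing.starProjection_smul {L : ClosedSubmodule DiscAlgebra R} (h : IsReducing L)
    (a : DiscAlgebra) (x : R) :
    (subspace L).starProjection (a • x) = a • (subspace L).starProjection x := by
  obtain ⟨L', h⟩ := h
  obtain ⟨y, hy, z, hz, rfl⟩ := Submodule.mem_sup.1 (h.2 ▸ Submodule.mem_top : x ∈ _)
  rw [smul_add, h.starProjection_eq hy hz,
    h.starProjection_eq (L.toSubmodule.smul_mem a hy) (L'.toSubmodule.smul_mem a hz)]

/-- The orthogonal projection onto a reducing submodule, as a module map. -/
def reducingProjection (L : reducingSubmodules R) : R →ₗ[DiscAlgebra] R where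
  toFun := (subspace (L : ClosedSubmodule DiscAlgebra R)).starProjection
  map_add' := map_add _
  map_smul' := IsReducing.starProjection_smul L.2

theorem reducingProjection_symm (L : reducingSubmodules R) (x y : R) :
    ⟪reducingProjection L x, y⟫_ℂ = ⟪x, reducingProjection L y⟫_ℂ :=
  Submodule.inner_starProjection_left_eq_right _ x y

theorem reducingProjection_injective :
    Function.Injective (reducingProjection : reducingSubmodules R → R →ₗ[DiscAlgebra] R) := by
  intro L M h
  have h1 : subspace (L : ClosedSubmodule DiscAlgebra R) =
      subspace (M : ClosedSubmodule DiscAlgebra R) :=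
    Submodule.starProjection_inj.1 (ContinuousLinearMap.ext fun x => LinearMap.congr_fun h x)
  refine Subtype.ext (SetLike.ext fun x => ?_)
  rw [← mem_subspace, h1, mem_subspace]

theorem reducingProjection_idem (L : reducingSubmodules R) (x : R) :
    reducingProjection L (reducingProjection L x) = reducingProjection L x := by
  change (subspace (L : ClosedSubmodule DiscAlgebra R)).starProjection _ = _
  rw [Submodule.starProjection_eq_self_iff]
  exact Submodule.starProjection_apply_mem (subspace (L : ClosedSubmodule DiscAlgebra R)) x

theorem fiberMap_reducingProjection_idem (L : reducingSubmodules R) (w : OpenDisc) :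
    IsIdempotentElem (fiberMap (reducingProjection L) w) := by
  refine LinearMap.ext fun u => ?_
  obtain ⟨f, rfl⟩ := hat_surjective w u
  simp [reducingProjection_idem]

/-- A closed submodule is recovered from its projection, so the inducing map is an embedding into a
Hausdorff space. -/
theorem discreteTopology_of_finite [Finite (reducingSubmodules R)] :
    DiscreteTopology (reducingSubmodules R) := by
  have hinj : Function.Injective fun L : reducingSubmodules R =>
      ((subspace (L : ClosedSubmodule DiscAlgebra R)).starProjection : R →L[ℂ] R) :=
    fun L M h => reducingProjection_injective
      (LinearMap.ext fun x => DFunLike.congr_fun h x)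
  have : T1Space (reducingSubmodules R) :=
    (Topology.IsEmbedding.mk ⟨rfl⟩ hinj).t1Space
  infer_instance

end DiscHilbertModule

/-! ### Idempotents commuting with an operator with simple spectrum -/

/-- There are finitely many idempotents commuting with an endomorphism of an `m`-dimensional space
which has `m` distinct eigenvalues. -/
theorem Module.End.finite_idempotents_commuting {V : Type*} [AddCommGroup V] [Module ℂ V]
    [FiniteDimensional ℂ V] (K : Module.End ℂ V)
    (hK : {μ : ℂ | K.HasEigenvalue μ}.ncard = Module.finrank ℂ V) :
    {P : Module.End ℂ V | IsIdempotentElem P ∧ Commute P K}.Finite := by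
  classical
  set S := {μ : ℂ | K.HasEigenvalue μ}
  have hS : S.Finite := Module.End.finite_hasEigenvalue K
  have := hS.fintype
  choose v hv using fun μ : S => Module.End.HasEigenvalue.exists_hasEigenvector μ.2
  have hli := K.eigenvectors_linearIndependent S v hv
  let b := basisOfLinearIndependentOfCardEqFinrank' v hli
    (by rw [← hK, Set.ncard_eq_toFinset_card', Set.toFinset_card])
  have hb : ∀ μ, b μ = v μ := fun μ => by simp [b]
  -- Commuting with `K` forces `P` to preserve each eigenline, since the eigenvalues are distinct.
  have key : ∀ P : Module.End ℂ V, Commute P K → ∀ μ, P (b μ) = b.repr (P (b μ)) μ • b μ := by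
    intro P hP μ
    have h1 : K (P (b μ)) = (μ : ℂ) • P (b μ) := by
      rw [← Module.End.mul_apply, ← hP.eq, Module.End.mul_apply, hb, (hv μ).apply_eq_smul, map_smul]
    have h2 : ∀ x, ∀ ν, b.repr (K x) ν = ν * b.repr x ν := by
      intro x ν
      have : (b.coord ν) ∘ₗ K = (ν : ℂ) • b.coord ν := b.ext fun κ => by
        simp only [LinearMap.comp_apply, hb, (hv κ).apply_eq_smul]
        rw [← hb]
        by_cases h : κ = ν
        · subst h; simp
        · simp [h]
      simpa using LinearMap.congr_fun this x
    refine b.repr.injective (Finsupp.ext fun ν => ?_)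
    by_cases h : μ = ν
    · subst h; simp
    · have h3 := h2 (P (b μ)) ν
      rw [h1] at h3
      have h4 : (μ : ℂ) ≠ ν := fun h' => h (Subtype.ext h')
      have h5 : b.repr (P (b μ)) ν = 0 := by simpa [h4] using h3
      simp [h, h5]
  -- On each eigenline an idempotent is 0 or the identity, so the set of basis vectors that `P`
  -- kills determines `P`.
  refine Set.Finite.of_finite_image (f := fun P : Module.End ℂ V => fun μ : S => P (b μ) = 0)
    (Set.toFinite _) ?_
  rintro P ⟨hP, hPK⟩ Q ⟨hQ, hQK⟩ hPQ
  have dich : ∀ P : Module.End ℂ V, IsIdempotentElem P → Commute P K → ∀ μ,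
      P (b μ) ≠ 0 → P (b μ) = b μ := by
    intro P hP hPK μ h
    have h1 := key P hPK μ
    set c := b.repr (P (b μ)) μ
    have h2 : P (P (b μ)) = P (b μ) := LinearMap.congr_fun hP (b μ)
    rw [h1, map_smul] at h2
    have hc : c ≠ 0 := fun hc => h (by rw [h1, hc, zero_smul])
    exact smul_right_injective V hc h2
  refine b.ext fun μ => ?_
  have h := congrFun hPQ μ
  simp only [eq_iff_iff] at h
  by_cases h0 : P (b μ) = 0
  · rw [h0, h.1 h0]
  · rw [dich P hP hPK μ h0, dich Q hQ hQK μ fun h' => h0 (h.2 h')]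

/-! ### Matrix-valued functions -/

section MatrixSmooth

variable {𝕜 : Type*} [NontriviallyNormedField 𝕜] {V A : Type*} [NormedAddCommGroup V]
  [NormedSpace 𝕜 V] [NormedField A] [NormedAlgebra 𝕜 A] {n : WithTop ℕ∞} {ι : Type*}
  [Fintype ι] [DecidableEq ι] {M N : V → Matrix ι ι A} {x : V}

theorem ContDiffAt.matrix_det (h : ∀ i j, ContDiffAt 𝕜 n (fun z => M z i j) x) :
    ContDiffAt 𝕜 n (fun z => (M z).det) x := by
  simp only [Matrix.det_apply]
  exact ContDiffAt.sum fun σ _ => ContDiffAt.const_smul _ (contDiffAt_prod fun i _ => h _ _)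

omit [DecidableEq ι] in
theorem ContDiffAt.matrix_mul (hM : ∀ i j, ContDiffAt 𝕜 n (fun z => M z i j) x)
    (hN : ∀ i j, ContDiffAt 𝕜 n (fun z => N z i j) x) (i j : ι) :
    ContDiffAt 𝕜 n (fun z => (M z * N z) i j) x := by
  simp only [Matrix.mul_apply]
  exact ContDiffAt.sum fun k _ => (hM i k).mul (hN k j)

theorem ContDiffAt.matrix_inv (h : ∀ i j, ContDiffAt 𝕜 n (fun z => M z i j) x)
    (hx : (M x).det ≠ 0) (i j : ι) : ContDiffAt 𝕜 n (fun z => (M z)⁻¹ i j) x := by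
  have : (fun z => (M z)⁻¹ i j) = fun z => (M z).det⁻¹ * (M z).adjugate i j := by
    ext z
    simp [Matrix.inv_def]
  rw [this]
  refine ((ContDiffAt.matrix_det h).inv hx).mul ?_
  simp only [Matrix.adjugate_apply]
  refine ContDiffAt.matrix_det fun k l => ?_
  -- In the adjugate, row `j` is replaced by a constant basis vector; the other rows are those of
  -- `M`.
  by_cases hk : k = j
  · subst hk
    simpa using contDiffAt_const
  · simpa [hk] using h k l

end MatrixSmooth

namespace DiscHilbertModule

/-! ### Wirtinger calculus for matrices -/

section Wirtinger

variable {f g : ℂ → ℂ} {z : ℂ}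

theorem wirtinger_mul (hf : DifferentiableAt ℝ f z) (hg : DifferentiableAt ℝ g z) :
    wirtinger (fun ζ => f ζ * g ζ) z = wirtinger f z * g z + f z * wirtinger g z := by
  simp only [wirtinger, fderiv_fun_mul hf hg, add_apply,
    smul_apply, smul_eq_mul]
  ring

theorem wirtingerBar_mul (hf : DifferentiableAt ℝ f z) (hg : DifferentiableAt ℝ g z) :
    wirtingerBar (fun ζ => f ζ * g ζ) z = wirtingerBar f z * g z + f z * wirtingerBar g z := by
  simp only [wirtingerBar, fderiv_fun_mul hf hg, add_apply,
    smul_apply, smul_eq_mul]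
  ring

theorem wirtinger_sum {ι : Type*} {s : Finset ι} {F : ι → ℂ → ℂ}
    (h : ∀ i ∈ s, DifferentiableAt ℝ (F i) z) :
    wirtinger (fun ζ => ∑ i ∈ s, F i ζ) z = ∑ i ∈ s, wirtinger (F i) z := by
  simp only [wirtinger, fderiv_fun_sum h, sum_apply, Finset.mul_sum,
    ← Finset.sum_sub_distrib, Finset.sum_div]

theorem wirtingerBar_sum {ι : Type*} {s : Finset ι} {F : ι → ℂ → ℂ}
    (h : ∀ i ∈ s, DifferentiableAt ℝ (F i) z) :
    wirtingerBar (fun ζ => ∑ i ∈ s, F i ζ) z = ∑ i ∈ s, wirtingerBar (F i) z := by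
  simp only [wirtingerBar, fderiv_fun_sum h, sum_apply, Finset.mul_sum,
    ← Finset.sum_add_distrib, Finset.sum_div]

theorem wirtingerBar_add (hf : DifferentiableAt ℝ f z) (hg : DifferentiableAt ℝ g z) :
    wirtingerBar (fun ζ => f ζ + g ζ) z = wirtingerBar f z + wirtingerBar g z := by
  simp only [wirtingerBar, fderiv_fun_add hf hg, add_apply]
  ring

theorem fderiv_real_apply (hf : DifferentiableAt ℂ f z) (v : ℂ) :
    fderiv ℝ f z v = v * deriv f z := by
  rw [hf.fderiv_restrictScalars ℝ]
  simp

theorem wirtingerBar_of_differentiableAt (hf : DifferentiableAt ℂ f z) :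
    wirtingerBar f z = 0 := by
  simp only [wirtingerBar, fderiv_real_apply hf]
  linear_combination (deriv f z / 2) * Complex.I_mul_I

theorem wirtinger_of_differentiableAt (hf : DifferentiableAt ℂ f z) :
    wirtinger f z = deriv f z := by
  simp only [wirtinger, fderiv_real_apply hf]
  linear_combination (-deriv f z / 2) * Complex.I_mul_I

theorem wirtinger_star_of_differentiableAt (hf : DifferentiableAt ℂ f z) :
    wirtinger (fun ζ => star (f ζ)) z = 0 := by
  have h : fderiv ℝ (fun ζ => star (f ζ)) z =
      (Complex.conjCLE : ℂ →L[ℝ] ℂ) ∘L fderiv ℝ f z :=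
    ((Complex.conjCLE : ℂ →L[ℝ] ℂ).hasFDerivAt.comp z
      (hf.restrictScalars ℝ).hasFDerivAt).fderiv
  simp only [wirtinger, h, ContinuousLinearMap.comp_apply, fderiv_real_apply hf]
  simp
  linear_combination (starRingEnd ℂ (deriv f z)) * Complex.I_mul_I

theorem _root_.Filter.EventuallyEq.wirtinger_eq (h : f =ᶠ[nhds z] g) :
    wirtinger f z = wirtinger g z := by
  rw [wirtinger, wirtinger, h.fderiv_eq]

theorem _root_.Filter.EventuallyEq.wirtingerBar_eq (h : f =ᶠ[nhds z] g) :
    wirtingerBar f z = wirtingerBar g z := by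
  rw [wirtingerBar, wirtingerBar, h.fderiv_eq]

theorem _root_.ContDiffAt.wirtinger (h : ContDiffAt ℝ ∞ f z) : ContDiffAt ℝ ∞ (wirtinger f) z := by
  have h1 : ContDiffAt ℝ ∞ (fderiv ℝ f) z := h.fderiv_right (by simp)
  have h2 : ∀ v, ContDiffAt ℝ ∞ (fun ζ => fderiv ℝ f ζ v) z := fun v =>
    h1.clm_apply contDiffAt_const
  exact ((h2 1).sub (contDiffAt_const.mul (h2 Complex.I))).div_const 2

end Wirtinger

section MatrixWirtinger

variable {ι : Type*} [Fintype ι] {M N : ℂ → Matrix ι ι ℂ} {z : ℂ}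

/-- The entrywise Wirtinger derivative `∂M`. -/
def matrixWirtinger (M : ℂ → Matrix ι ι ℂ) (z : ℂ) : Matrix ι ι ℂ :=
  Matrix.of fun i j => wirtinger (fun ζ => M ζ i j) z

/-- The entrywise Wirtinger derivative `∂̄M`. -/
def matrixWirtingerBar (M : ℂ → Matrix ι ι ℂ) (z : ℂ) : Matrix ι ι ℂ :=
  Matrix.of fun i j => wirtingerBar (fun ζ => M ζ i j) z

theorem matrixWirtinger_mul (hM : ∀ i j, DifferentiableAt ℝ (fun ζ => M ζ i j) z)
    (hN : ∀ i j, DifferentiableAt ℝ (fun ζ => N ζ i j) z) :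
    matrixWirtinger (fun ζ => M ζ * N ζ) z =
      matrixWirtinger M z * N z + M z * matrixWirtinger N z := by
  ext i j
  simp only [matrixWirtinger, Matrix.of_apply, Matrix.mul_apply, Matrix.add_apply]
  rw [wirtinger_sum fun k _ => (hM i k).fun_mul (hN k j), ← Finset.sum_add_distrib]
  exact Finset.sum_congr rfl fun k _ => wirtinger_mul (hM i k) (hN k j)

theorem matrixWirtingerBar_mul (hM : ∀ i j, DifferentiableAt ℝ (fun ζ => M ζ i j) z)
    (hN : ∀ i j, DifferentiableAt ℝ (fun ζ => N ζ i j) z) :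
    matrixWirtingerBar (fun ζ => M ζ * N ζ) z =
      matrixWirtingerBar M z * N z + M z * matrixWirtingerBar N z := by
  ext i j
  simp only [matrixWirtingerBar, Matrix.of_apply, Matrix.mul_apply, Matrix.add_apply]
  rw [wirtingerBar_sum fun k _ => (hM i k).fun_mul (hN k j), ← Finset.sum_add_distrib]
  exact Finset.sum_congr rfl fun k _ => wirtingerBar_mul (hM i k) (hN k j)

omit [Fintype ι] in
theorem matrixWirtinger_congr (h : ∀ᶠ ζ in nhds z, M ζ = N ζ) :
    matrixWirtinger M z = matrixWirtinger N z := by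
  ext i j
  exact Filter.EventuallyEq.wirtinger_eq (h.mono fun ζ hζ => by simp only [hζ])

omit [Fintype ι] in
theorem matrixWirtingerBar_congr (h : ∀ᶠ ζ in nhds z, M ζ = N ζ) :
    matrixWirtingerBar M z = matrixWirtingerBar N z := by
  ext i j
  exact Filter.EventuallyEq.wirtingerBar_eq (h.mono fun ζ hζ => by simp only [hζ])

/-- A holomorphic matrix function `A` which is self-adjoint with respect to the metric `H` is
parallel for the Chern connection `H⁻¹∂H`, and therefore commutes with its curvature. -/
theorem commute_curvature_of_selfAdjoint [DecidableEq ι] {H A : ℂ → Matrix ι ι ℂ}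
    (hH : ∀ i j, ContDiffAt ℝ ∞ (fun ζ => H ζ i j) z)
    (hA : ∀ i j, AnalyticAt ℂ (fun ζ => A ζ i j) z)
    (hdet : (H z).det ≠ 0)
    (hHA : ∀ᶠ ζ in nhds z, H ζ * A ζ = (A ζ).conjTranspose * H ζ) :
    Commute (A z) (matrixWirtingerBar (fun ζ => (H ζ)⁻¹ * matrixWirtinger H ζ) z) := by
  set G := fun ζ => (H ζ)⁻¹ * matrixWirtinger H ζ
  have hdH : ∀ i j, ContDiffAt ℝ ∞ (fun ζ => matrixWirtinger H ζ i j) z :=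
    fun i j => (hH i j).wirtinger
  have hG : ∀ i j, DifferentiableAt ℝ (fun ζ => G ζ i j) z := fun i j =>
    (ContDiffAt.matrix_mul (ContDiffAt.matrix_inv hH hdet) hdH i j).differentiableAt (by simp)
  have hdet' : ∀ᶠ ζ in nhds z, (H ζ).det ≠ 0 :=
    (ContDiffAt.matrix_det hH).continuousAt.eventually_ne hdet
  have hA' : ∀ᶠ ζ in nhds z, ∀ i j, AnalyticAt ℂ (fun ζ => A ζ i j) ζ :=
    Filter.eventually_all.2 fun i => Filter.eventually_all.2 fun j =>
      (hA i j).eventually_analyticAt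
  have hH' : ∀ᶠ ζ in nhds z, ∀ i j, DifferentiableAt ℝ (fun ζ => H ζ i j) ζ :=
    Filter.eventually_all.2 fun i => Filter.eventually_all.2 fun j =>
      (((hH i j).of_le (m := 1) (by simp)).eventually (by simp)).mono
        fun ζ hζ => hζ.differentiableAt (by simp)
  -- Apply `∂` to `HA = A*H`: the term with `∂A*` drops out because `A*` is antiholomorphic.
  -- Multiplying by `H⁻¹` and using `H⁻¹A* = AH⁻¹` gives `∂A + GA = AG`. It is needed on a whole
  -- neighbourhood because it is differentiated again.
  have hpar : ∀ᶠ ζ in nhds z, G ζ * A ζ + matrixWirtinger A ζ = A ζ * G ζ := by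
    filter_upwards [hdet', hA', hH', hHA.eventually_nhds] with ζ h1 h2 h3 h4
    have hAd : ∀ i j, DifferentiableAt ℝ (fun ζ => A ζ i j) ζ := fun i j =>
      (h2 i j).differentiableAt.restrictScalars ℝ
    have hstar : ∀ i j, DifferentiableAt ℝ (fun ζ => (A ζ).conjTranspose i j) ζ := fun i j =>
      (hAd j i).star
    have h5 := matrixWirtinger_congr h4
    rw [matrixWirtinger_mul h3 hAd, matrixWirtinger_mul hstar h3] at h5
    have h6 : matrixWirtinger (fun ζ => (A ζ).conjTranspose) ζ = 0 := by
      ext i j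
      exact wirtinger_star_of_differentiableAt (h2 j i).differentiableAt
    rw [h6, zero_mul, zero_add] at h5
    have hu : IsUnit (H ζ).det := isUnit_iff_ne_zero.2 h1
    have h7 : A ζ = (H ζ)⁻¹ * ((A ζ).conjTranspose * H ζ) := by
      rw [← h4.self_of_nhds, Matrix.nonsing_inv_mul_cancel_left _ _ hu]
    have h8 : A ζ * (H ζ)⁻¹ = (H ζ)⁻¹ * (A ζ).conjTranspose := by
      conv_lhs => rw [h7]
      rw [Matrix.mul_assoc, Matrix.mul_nonsing_inv_cancel_right _ _ hu]
    calc G ζ * A ζ + matrixWirtinger A ζ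
        = (H ζ)⁻¹ * (matrixWirtinger H ζ * A ζ + H ζ * matrixWirtinger A ζ) := by
          rw [Matrix.mul_add, Matrix.nonsing_inv_mul_cancel_left _ _ hu, ← Matrix.mul_assoc]
      _ = A ζ * G ζ := by
          rw [h5, ← Matrix.mul_assoc, ← h8, Matrix.mul_assoc]
  have hAz : ∀ i j, DifferentiableAt ℝ (fun ζ => A ζ i j) z := fun i j =>
    (hA i j).differentiableAt.restrictScalars ℝ
  have hbarA : matrixWirtingerBar A z = 0 := by
    ext i j
    exact wirtingerBar_of_differentiableAt (hA i j).differentiableAt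
  have hdA : ∀ i j, (fun ζ => matrixWirtinger A ζ i j) =ᶠ[nhds z]
      deriv (fun ζ => A ζ i j) := fun i j =>
    hA'.mono fun ζ hζ => wirtinger_of_differentiableAt (hζ i j).differentiableAt
  have hdA' : ∀ i j, DifferentiableAt ℂ (fun ζ => matrixWirtinger A ζ i j) z := fun i j =>
    (hdA i j).differentiableAt_iff.2 (hA i j).deriv.differentiableAt
  -- Apply `∂̄` to the parallelism equation: `∂̄A` and `∂̄∂A` vanish, leaving the commutation of `A`
  -- with `∂̄G`.
  have h := matrixWirtingerBar_congr hpar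
  have hadd : matrixWirtingerBar (fun ζ => G ζ * A ζ + matrixWirtinger A ζ) z =
      matrixWirtingerBar (fun ζ => G ζ * A ζ) z := by
    ext i j
    have h1 : DifferentiableAt ℝ (fun ζ => (G ζ * A ζ) i j) z := by
      simp only [Matrix.mul_apply]
      exact DifferentiableAt.fun_sum fun k _ => (hG i k).mul (hAz k j)
    refine (wirtingerBar_add h1 ((hdA' i j).restrictScalars ℝ)).trans ?_
    rw [wirtingerBar_of_differentiableAt (hdA' i j), add_zero]
    rfl
  rw [hadd, matrixWirtingerBar_mul hG hAz, matrixWirtingerBar_mul hAz hG, hbarA, mul_zero,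
    add_zero, zero_mul, zero_add] at h
  exact h.symm

end MatrixWirtinger

/-- A holomorphic function on the disc with real values is constant. -/
theorem eq_of_analyticOnNhd_of_real {f : ℂ → ℂ} {U : Set ℂ} (hU : IsOpen U) (hU' : IsPreconnected U)
    (hf : AnalyticOnNhd ℂ f U) (hreal : ∀ z ∈ U, (f z).im = 0) {z w : ℂ} (hz : z ∈ U)
    (hw : w ∈ U) : f z = f w := by
  rcases hf.is_constant_or_isOpen hU' with ⟨c, hc⟩ | h
  · rw [hc z hz, hc w hw]
  -- A nonconstant `f` would be open, and then its imaginary part would have an open image inside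
  -- `{0}`.
  · exfalso
    have h1 := (Complex.isOpenMap_im _ (h U subset_rfl hU)).mem_nhds
      (Set.mem_image_of_mem _ (Set.mem_image_of_mem f hz))
    have h2 : Complex.im '' (f '' U) ⊆ {0} := by
      rintro _ ⟨_, ⟨x, hx, rfl⟩, rfl⟩
      exact hreal x hx
    have h3 : ({0} : Set ℝ) ∈ nhds (f z).im := Filter.mem_of_superset h1 h2
    rw [hreal z hz] at h3
    exact not_isOpen_singleton (0 : ℝ) (isOpen_singleton_iff_nhds_eq_pure _ |>.2
      (le_antisymm (Filter.le_pure_iff.2 h3) (pure_le_nhds _)))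

end DiscHilbertModule

namespace DiscHilbertModule

/-! ### Functions on the disc as functions of a complex variable -/

/-- Extension by zero of a function on the disc. -/
def discExtend {X : Type*} [Zero X] (f : OpenDisc → X) : ℂ → X :=
  Function.extend (fun w : OpenDisc => (w : ℂ)) f 0

@[simp]
theorem discExtend_coe {X : Type*} [Zero X] (f : OpenDisc → X) (w : OpenDisc) :
    discExtend f w = f w :=
  Function.Injective.extend_apply Subtype.val_injective f 0 w

/-- The disc is open in `ℂ`, so the values of an extension outside it never affect germs at its
points. -/
theorem eventually_nhds_coe_iff {w : OpenDisc} {p : ℂ → Prop} :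
    (∀ᶠ z in nhds (w : ℂ), p z) ↔ ∀ᶠ v : OpenDisc in nhds w, p v := by
  rw [← OpenDisc.isOpen.isOpenEmbedding_subtypeVal.map_nhds_eq w]
  rfl

theorem contDiffAt_of_contMDiffAt_coe {𝕜 : Type*} [NontriviallyNormedField 𝕜]
    [NormedAlgebra 𝕜 ℂ] {n : WithTop ℕ∞} {f : ℂ → ℂ} {w : OpenDisc}
    (h : ContMDiffAt 𝓘(𝕜, ℂ) 𝓘(𝕜, ℂ) n (fun v : OpenDisc => f v) w) : ContDiffAt 𝕜 n f w :=
  contMDiffAt_iff_contDiffAt.1 (contMDiffAt_subtype_iff.1 h)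

/-! ### Module maps in the coordinates of a local trivialization -/

section Bundle

variable {R : Type*} [NormedAddCommGroup R] [InnerProductSpace ℂ R] [DiscHilbertModule R] {m : ℕ}
  [TopologicalSpace (TotalSpace (ModelFiber m) (Fiber R))] [FiberBundle (ModelFiber m) (Fiber R)]
  [VectorBundle ℂ (ModelFiber m) (Fiber R)]
  (e : Trivialization (ModelFiber m) (π (ModelFiber m) (Fiber R))) [MemTrivializationAtlas e]

/-- The basis of a fibre given by a trivialization. -/
def fiberBasis {w : OpenDisc} (hw : w ∈ e.baseSet) : Module.Basis (Fin m) ℂ (Fiber R w) :=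
  (PiLp.basisFun 2 ℂ (Fin m)).map (e.linearEquivAt ℂ w hw).symm

theorem fiberBasis_apply {w : OpenDisc} (hw : w ∈ e.baseSet) (i : Fin m) :
    fiberBasis e hw i = e.symm w (EuclideanSpace.single i 1) := by
  simp only [fiberBasis, Module.Basis.map_apply, Trivialization.linearEquivAt_symm_apply]
  rw [PiLp.basisFun_apply]

theorem fiberBasis_repr {w : OpenDisc} (hw : w ∈ e.baseSet) (u : Fiber R w) (i : Fin m) :
    (fiberBasis e hw).repr u i = (e ⟨w, u⟩).2 i := rfl

theorem conj_symm_toLpLin {w : OpenDisc} (hw : w ∈ e.baseSet) (M : Matrix (Fin m) (Fin m) ℂ) :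
    (e.linearEquivAt ℂ w hw).symm.conj (Matrix.toLpLin 2 2 M) =
      Matrix.toLin (fiberBasis e hw) (fiberBasis e hw) M := by
  refine (fiberBasis e hw).ext fun j => ?_
  rw [Matrix.toLin_self, LinearEquiv.conj_apply_apply, LinearEquiv.symm_symm]
  refine (e.linearEquivAt ℂ w hw).injective ?_
  rw [LinearEquiv.apply_symm_apply]
  simp only [fiberBasis, Module.Basis.map_apply, LinearEquiv.apply_symm_apply, map_sum, map_smul]
  rw [Matrix.toLpLin_eq_toLin, Matrix.toLin_self]

/-- The matrix of the map of a fibre induced by `T`, in the frame of a trivialization. -/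
def coordMatrix (T : R →ₗ[DiscAlgebra] R) (w : OpenDisc) : Matrix (Fin m) (Fin m) ℂ :=
  Matrix.of fun i j => (e ⟨w, fiberMap T w (e.symm w (EuclideanSpace.single j 1))⟩).2 i

theorem coordMatrix_eq {w : OpenDisc} (hw : w ∈ e.baseSet) (T : R →ₗ[DiscAlgebra] R) :
    coordMatrix e T w =
      LinearMap.toMatrix (fiberBasis e hw) (fiberBasis e hw) (fiberMap T w) := by
  ext i j
  rw [LinearMap.toMatrix_apply, fiberBasis_repr, fiberBasis_apply]
  rfl

/-- The matrix of coordinates of the sections defined by a family of vectors. -/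
def hatMatrix (f : Fin m → R) (w : OpenDisc) : Matrix (Fin m) (Fin m) ℂ :=
  Matrix.of fun i j => (e ⟨w, hat (f j) w⟩).2 i

theorem coordMatrix_mul_hatMatrix {w : OpenDisc} (hw : w ∈ e.baseSet) (T : R →ₗ[DiscAlgebra] R)
    (f : Fin m → R) : coordMatrix e T w * hatMatrix e f w = hatMatrix e (T ∘ f) w := by
  have h : ∀ g : Fin m → R, hatMatrix e g w = (fiberBasis e hw).toMatrix fun j => hat (g j) w :=
    fun g => by
      ext i j
      rw [Module.Basis.toMatrix_apply, fiberBasis_repr]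
      rfl
  rw [h, h, coordMatrix_eq e hw]
  ext i j
  rw [Matrix.mul_apply]
  have := congrFun (LinearMap.toMatrix_mulVec_repr (fiberBasis e hw) (fiberBasis e hw)
    (fiberMap T w) (hat (f j) w)) i
  rw [fiberMap_hat] at this
  exact this

variable [ContMDiffVectorBundle ω (ModelFiber m) (Fiber R) 𝓘(ℂ, ℂ)]

theorem contDiffAt_hatMatrix
    (hhat : ∀ f : R, ContMDiff 𝓘(ℂ, ℂ) (𝓘(ℂ, ℂ).prod 𝓘(ℂ, ModelFiber m)) ω
      (fun w => TotalSpace.mk' (ModelFiber m) w (hat f w)))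
    {w : OpenDisc} (hw : w ∈ e.baseSet) (f : Fin m → R) (i j : Fin m) :
    ContDiffAt ℂ ω (fun z => discExtend (hatMatrix e f) z i j) w := by
  refine contDiffAt_of_contMDiffAt_coe ?_
  simp only [discExtend_coe]
  have h1 := (e.contMDiffAt_section_iff hw).1 ((hhat (f j)).contMDiffAt (x := w))
  exact (EuclideanSpace.proj i : ModelFiber m →L[ℂ] ℂ).contMDiff.contMDiffAt.comp w h1

/-- Choose vectors `f_j` whose sections form the frame at `w`. Their coordinate matrix is
holomorphic and stays invertible near `w`, so the matrix of `T` is the holomorphic quotient of the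
coordinate matrix of the `T f_j` by that of the `f_j`. -/
theorem analyticAt_coordMatrix
    (hhat : ∀ f : R, ContMDiff 𝓘(ℂ, ℂ) (𝓘(ℂ, ℂ).prod 𝓘(ℂ, ModelFiber m)) ω
      (fun w => TotalSpace.mk' (ModelFiber m) w (hat f w)))
    {w : OpenDisc} (hw : w ∈ e.baseSet) (T : R →ₗ[DiscAlgebra] R) (i j : Fin m) :
    AnalyticAt ℂ (fun z => discExtend (coordMatrix e T) z i j) w := by
  choose f hf using fun j => hat_surjective w (fiberBasis e hw j)
  have hone : hatMatrix e f w = 1 := by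
    ext i j
    rw [hatMatrix, Matrix.of_apply, hf, ← fiberBasis_repr e hw, Module.Basis.repr_self,
      Finsupp.single_apply, Matrix.one_apply]
    simp only [eq_comm]
  have hF := contDiffAt_hatMatrix e hhat hw f
  have hdet : (discExtend (hatMatrix e f) w).det ≠ 0 := by simp [hone]
  have hdet' : ∀ᶠ z in nhds (w : ℂ), (discExtend (hatMatrix e f) z).det ≠ 0 :=
    (ContDiffAt.matrix_det hF).continuousAt.eventually_ne hdet
  refine ContDiffAt.analyticAt (ContDiffAt.congr_of_eventuallyEq
    (ContDiffAt.matrix_mul (contDiffAt_hatMatrix e hhat hw (T ∘ f))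
      (ContDiffAt.matrix_inv hF hdet) i j) ?_)
  rw [eventually_nhds_coe_iff] at hdet'
  refine eventually_nhds_coe_iff.2 ?_
  filter_upwards [hdet', e.open_baseSet.mem_nhds hw] with v hv hv'
  simp only [discExtend_coe] at hv ⊢
  rw [← coordMatrix_mul_hatMatrix e hv',
    Matrix.mul_nonsing_inv_cancel_right _ _ (isUnit_iff_ne_zero.2 hv)]

/-- The trace does not depend on the frame, so each point may use its own trivialization. -/
theorem analyticAt_trace
    (hhat : ∀ f : R, ContMDiff 𝓘(ℂ, ℂ) (𝓘(ℂ, ℂ).prod 𝓘(ℂ, ModelFiber m)) ω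
      (fun w => TotalSpace.mk' (ModelFiber m) w (hat f w)))
    (T : R →ₗ[DiscAlgebra] R) (w : OpenDisc) :
    AnalyticAt ℂ (discExtend fun v =>
      LinearMap.trace ℂ (Fiber R v) (fiberMap T v * fiberMap T v)) w := by
  let e := trivializationAt (ModelFiber m) (Fiber R) w
  have hw : w ∈ e.baseSet := mem_baseSet_trivializationAt (ModelFiber m) (Fiber R) w
  have hA := analyticAt_coordMatrix e hhat hw T
  have h : AnalyticAt ℂ (fun z => ∑ i, ∑ k, discExtend (coordMatrix e T) z i k *
      discExtend (coordMatrix e T) z k i) w :=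
    Finset.analyticAt_fun_sum _ fun i _ => Finset.analyticAt_fun_sum _ fun k _ =>
      (hA i k).mul (hA k i)
  refine h.congr (eventually_nhds_coe_iff.2 ?_)
  filter_upwards [e.open_baseSet.mem_nhds hw] with v hv
  simp only [discExtend_coe]
  rw [LinearMap.trace_eq_matrix_trace ℂ (fiberBasis e hv), LinearMap.toMatrix_mul,
    ← coordMatrix_eq]
  simp [Matrix.trace, Matrix.mul_apply]

end Bundle

/-! ### Locality and parallelism of self-adjoint module maps -/

namespace QuasiFree

variable {R : Type*} [NormedAddCommGroup R] [InnerProductSpace ℂ R] [DiscHilbertModule R] {m : ℕ}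

theorem finiteDimensional_fiber (E : QuasiFree R m) (w : OpenDisc) : FiniteDimensional ℂ (Fiber R w) :=
  Module.finite_of_rank_eq_nat (E.rank_fiber w)

theorem finrank_fiber (E : QuasiFree R m) (w : OpenDisc) : Module.finrank ℂ (Fiber R w) = m :=
  Module.finrank_eq_of_rank_eq (E.rank_fiber w)

/-- A self-adjoint module map is determined by its action on one fibre: its Hilbert–Schmidt norm
on the fibres is holomorphic, hence constant. -/
theorem eq_zero_of_fiberMap_eq_zero (E : QuasiFree R m) {T : R →ₗ[DiscAlgebra] R}
    (hT : ∀ x y, ⟪T x, y⟫_ℂ = ⟪x, T y⟫_ℂ) {w₀ : OpenDisc} (h0 : fiberMap T w₀ = 0) : T = 0 := by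
  let _ := E.topology
  let _ := E.fiberBundle
  let _ := E.vectorBundle
  let _ := E.holomorphicBundle
  have hfin := E.finiteDimensional_fiber
  have h : ∀ w, fiberMap T w = 0 := fun w => by
    obtain ⟨r, hr, hr0⟩ := trace_fiberMap_sq w hT
    refine hr0 ?_
    have h1 := eq_of_analyticOnNhd_of_real (U := Metric.ball 0 1) Metric.isOpen_ball
      (convex_ball (0 : ℂ) 1).isPreconnected
      (fun z hz => analyticAt_trace E.holomorphic_hat T ⟨z, hz⟩) (fun z hz => by
        obtain ⟨s, hs, -⟩ := trace_fiberMap_sq ⟨z, hz⟩ hT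
        rw [discExtend_coe (w := ⟨z, hz⟩), hs, Complex.ofReal_im]) w.2 w₀.2
    rw [discExtend_coe, discExtend_coe, hr, h0, mul_zero, map_zero] at h1
    exact_mod_cast h1
  refine LinearMap.ext fun f => E.injective_hat (funext fun w => ?_)
  rw [← fiberMap_hat, h w]
  exact ((maxIdealMul R (w : ℂ)).mkQ.map_zero).symm

theorem gram_coe (E : QuasiFree R m) (w₀ w : OpenDisc) (i j : Fin m) :
    E.gram w₀ w i j = fiberInner w (E.frame w₀ i w) (E.frame w₀ j w) := by
  rw [gram, Function.Injective.extend_apply Subtype.val_injective]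
  rfl

theorem contDiffAt_gram (E : QuasiFree R m) (w₀ : OpenDisc) (i j : Fin m) :
    ContDiffAt ℝ ∞ (fun z => E.gram w₀ z i j) w₀ := by
  let _ := E.topology
  let _ := E.fiberBundle
  let _ := E.vectorBundle
  let _ := E.holomorphicBundle
  let e := trivializationAt (ModelFiber m) (Fiber R) w₀
  have hw : w₀ ∈ e.baseSet := mem_baseSet_trivializationAt (ModelFiber m) (Fiber R) w₀
  -- The frame is constant in its trivialization, hence holomorphic, as the smoothness condition on
  -- the metric requires.
  have hs : ∀ i, ContMDiffOn 𝓘(ℂ, ℂ) (𝓘(ℂ, ℂ).prod 𝓘(ℂ, ModelFiber m)) ω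
      (fun w => TotalSpace.mk' (ModelFiber m) w (E.frame w₀ i w)) e.baseSet := fun i => by
    rw [e.contMDiffOn_section_baseSet_iff]
    refine (contMDiffOn_const (c := EuclideanSpace.single i 1)).congr fun w hw => ?_
    exact congrArg Prod.snd (e.apply_mk_symm hw _)
  refine contDiffAt_of_contMDiffAt_coe ?_
  simp only [gram_coe]
  exact (E.smooth_metric e.baseSet e.open_baseSet _ _ (hs i) (hs j)).contMDiffAt
    (e.open_baseSet.mem_nhds hw)

theorem commute_fiberMap_curvature (E : QuasiFree R m) {T : R →ₗ[DiscAlgebra] R}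
    (hT : ∀ x y, ⟪T x, y⟫_ℂ = ⟪x, T y⟫_ℂ) (w₀ : OpenDisc) :
    Commute (fiberMap T w₀) (E.curvature w₀) := by
  let _ := E.topology
  let _ := E.fiberBundle
  let _ := E.vectorBundle
  let _ := E.holomorphicBundle
  have hfin := E.finiteDimensional_fiber
  let e := trivializationAt (ModelFiber m) (Fiber R) w₀
  have hw : w₀ ∈ e.baseSet := mem_baseSet_trivializationAt (ModelFiber m) (Fiber R) w₀
  have hgram : ∀ {w : OpenDisc} (hw : w ∈ e.baseSet) i j, E.gram w₀ w i j =
      fiberInner w (fiberBasis e hw i) (fiberBasis e hw j) := fun {w} hw i j => by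
    rw [gram_coe, fiberBasis_apply, fiberBasis_apply]
    rfl
  have hdet : (E.gram w₀ w₀).det ≠ 0 := by
    have h1 : LinearIndependent ℂ fun i => fiberLift w₀ (fiberBasis e hw i) :=
      (fiberBasis e hw).linearIndependent.map' _
        (LinearMap.ker_eq_bot.2 (fiberLift_injective w₀))
    have h2 : E.gram w₀ w₀ = Matrix.gram ℂ fun i => fiberLift w₀ (fiberBasis e hw i) := by
      ext i j
      rw [hgram hw]
      rfl
    rw [h2]
    exact Matrix.det_gram_ne_zero_iff_linearIndependent.2 h1
  -- The entries of the two sides are `⟨b_i, T b_j⟩` and `⟨T b_i, b_j⟩`, with the inner product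
  -- conjugate linear in the first variable.
  have hself : ∀ᶠ z in nhds (w₀ : ℂ), E.gram w₀ z * discExtend (coordMatrix e T) z =
      (discExtend (coordMatrix e T) z).conjTranspose * E.gram w₀ z := by
    refine eventually_nhds_coe_iff.2 ?_
    filter_upwards [e.open_baseSet.mem_nhds hw] with w hw
    rw [discExtend_coe, coordMatrix_eq e hw]
    set b := fiberBasis e hw
    set A := LinearMap.toMatrix b b (fiberMap T w)
    have hA : ∀ j, fiberMap T w (b j) = ∑ k, A k j • b k := fun j => by
      conv_lhs => rw [← Matrix.toLin_toMatrix b b (fiberMap T w), Matrix.toLin_self]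
    ext i j
    have h := fiberInner_fiberMap w hT (b i) (b j)
    rw [hA, hA] at h
    simp only [fiberInner, map_sum, map_smul, sum_inner, inner_sum, inner_smul_left,
      inner_smul_right] at h
    simp only [Matrix.mul_apply, Matrix.conjTranspose_apply, hgram hw, ← starRingEnd_apply]
    exact (Finset.sum_congr rfl fun k _ => mul_comm _ _).trans h.symm
  have h := commute_curvature_of_selfAdjoint (E.contDiffAt_gram w₀)
    (analyticAt_coordMatrix e E.holomorphic_hat hw T) hdet hself
  rw [discExtend_coe, coordMatrix_eq e hw] at h
  have h1 : E.curvature w₀ = Matrix.toLin (fiberBasis e hw) (fiberBasis e hw)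
    (E.curvatureMatrix w₀ w₀) := conj_symm_toLpLin e hw _
  have h2 := h.map (Matrix.toLinAlgEquiv (fiberBasis e hw))
  rw [h1]
  have h3 : Matrix.toLinAlgEquiv (fiberBasis e hw) (LinearMap.toMatrix (fiberBasis e hw)
      (fiberBasis e hw) (fiberMap T w₀)) = fiberMap T w₀ := Matrix.toLin_toMatrix _ _ _
  rw [h3] at h2
  exact h2

theorem finite_reducingSubmodules (E : QuasiFree R m) {w₀ : OpenDisc}
    (hK : {μ : ℂ | (E.curvature w₀).HasEigenvalue μ}.ncard = m) :
    Finite (reducingSubmodules R) := by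
  have hfin := E.finiteDimensional_fiber w₀
  have hS := Module.End.finite_idempotents_commuting (E.curvature w₀)
    (hK.trans (E.finrank_fiber w₀).symm)
  have := hS.to_subtype
  refine Finite.of_injective (β := {P : Module.End ℂ (Fiber R w₀) | IsIdempotentElem P ∧
    Commute P (E.curvature w₀)}) (fun L => ⟨fiberMap (reducingProjection L) w₀,
      fiberMap_reducingProjection_idem L w₀,
      E.commute_fiberMap_curvature (reducingProjection_symm L) w₀⟩) fun L M h => ?_
  -- Locality is applied to the difference of the two projections, which is self-adjoint though no
  -- longer idempotent.
  refine reducingProjection_injective (sub_eq_zero.1 (E.eq_zero_of_fiberMap_eq_zero (w₀ := w₀)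
    (fun x y => ?_) ?_))
  · simp only [LinearMap.sub_apply, inner_sub_left, inner_sub_right, reducingProjection_symm]
  · rw [fiberMap_sub, sub_eq_zero]
    exact congrArg Subtype.val h

end QuasiFree

end DiscHilbertModule

theorem theorem2p2 {R : Type*} [NormedAddCommGroup R] [InnerProductSpace ℂ R]
    [DiscHilbertModule R] {m : ℕ} (E : DiscHilbertModule.QuasiFree R m) (w₀ : OpenDisc)
    (hK : {μ : ℂ | (E.curvature w₀).HasEigenvalue μ}.ncard = m) :
    Finite (DiscHilbertModule.reducingSubmodules R) ∧
      DiscreteTopology (DiscHilbertModule.reducingSubmodules R) := by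
  have := E.finite_reducingSubmodules hK
  exact ⟨this, DiscHilbertModule.discreteTopology_of_finite⟩

end
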